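/- Let $M$ be a smooth ($C^\infty$, Hausdorff, boundaryless) $n$-dimensional manifold with a smooth Riemannian metric $g$ and a smooth affine connection $\nabla$. Let $\hat\nabla$ be the Levi-Civita connection of $g$, let $K(X,Y)=\nabla_XY-\hat\nabla_XY$, and let $A(X,Y,Z)=g(K(X,Y),Z)$ be the cubic form of $(g,\nabla)$. The pair $(g,\nabla)$ is called a statistical structure if $\nabla$ is torsion-free and the cubic form $\nabla g$ is symmetric in all its arguments; it is called trivial if $\nabla=\hat\nabla$. The connection $\nabla$ is called geodesically complete if for every $x\in M$ and $v\in T_xM$ there is a $\nabla$-geodesic $\gamma:\mathbb R\to M$, in affine parametrization, with $\gamma(0)=x$ and $\dot\gamma(0)=v$. (1) If $(g,\nabla)$ is a statistical structure, $\nabla$ is geodesically complete and $(\hat\nabla A)(U,U,U,U)\le 0$ for every $g$-unit tangent vector $U$ of $M$, then $(g,\nabla)$ is trivial. (2) In particular, if $(g,\nabla)$ is a nontrivial statistical structure with $\hat\nabla A=0$, then $\nabla$ is not geodesically complete. (3) In particular, let $f:M\to\mathbb R^{n+1}$ be a smooth immersion and $\xi:M\to\mathbb R^{n+1}$ a smooth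 vector field along $f$ transversal to $f$, and suppose that $g$ and $\nabla$ are induced by $(f,\xi)$ through the Gauss formula $D_Xf_*Y=f_*(\nabla_XY)+g(X,Y)\,\xi$, where $D$ is the standard flat connection of $\mathbb R^{n+1}$, and that $\xi$ is equiaffine, that is, $\nabla\nu_\xi=0$ for $\nu_\xi(X_1,\dots,X_n)=\det(f_*X_1,\dots,f_*X_n,\xi)$. If $\hat\nabla A=0$ and $\nabla\ne\hat\nabla$, then $\nabla$ is not geodesically complete. -/

import Mathlib

open Bundle NormedSpace FiberBundle VectorField
open scoped Manifold ContDiff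

set_option linter.unusedSectionVars false

noncomputable section

namespace StatGeom

section Connections

variable {E : Type*} [NormedAddCommGroup E] [NormedSpace ℝ E] [FiniteDimensional ℝ E]
  {H : Type*} [TopologicalSpace H] {I : ModelWithCorners ℝ E H}
  {M : Type*} [TopologicalSpace M] [ChartedSpace H M] [IsManifold I ∞ M]
  [RiemannianBundle (fun x : M ↦ TangentSpace I x)]
  [IsContMDiffRiemannianBundle I ∞ E (fun x : M ↦ TangentSpace I x)]

theorem mdifferentiableAt_inner {x : M} {X Y : Π x : M, TangentSpace I x}
    (hX : MDiffAt (T% X) x) (hY : MDiffAt (T% Y) x) :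
    MDiffAt (fun y ↦ inner ℝ (X y) (Y y)) x :=
  MDifferentiableAt.inner_bundle (E := fun x : M ↦ TangentSpace I x) (F := E) hX hY

theorem mvfderiv_inner_add {x : M} {X X' Y : Π x : M, TangentSpace I x}
    (hX : MDiffAt (T% X) x) (hX' : MDiffAt (T% X') x) (hY : MDiffAt (T% Y) x) :
    mvfderiv I (fun y ↦ inner ℝ ((X + X') y) (Y y)) x
      = mvfderiv I (fun y ↦ inner ℝ (X y) (Y y)) x
        + mvfderiv I (fun y ↦ inner ℝ (X' y) (Y y)) x := by
  rw [← mvfderiv_fun_add (mdifferentiableAt_inner hX hY) (mdifferentiableAt_inner hX' hY)]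
  congr 1; ext y; simp [inner_add_left]

theorem mvfderiv_inner_smul {x : M} {f : M → ℝ} {X Y : Π x : M, TangentSpace I x}
    (hf : MDiffAt f x) (hX : MDiffAt (T% X) x) (hY : MDiffAt (T% Y) x) :
    mvfderiv I (fun y ↦ inner ℝ ((f • X) y) (Y y)) x
      = f x • mvfderiv I (fun y ↦ inner ℝ (X y) (Y y)) x
        + inner ℝ (X x) (Y x) • mvfderiv I f x := by
  rw [← mvfderiv_fun_mul hf (mdifferentiableAt_inner hX hY)]
  congr 1; ext y; simp [inner_smul_left]

theorem mvfderiv_inner_comm (x : M) (X Y : Π x : M, TangentSpace I x) :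
    mvfderiv I (fun y ↦ inner ℝ (X y) (Y y)) x
      = mvfderiv I (fun y ↦ inner ℝ (Y y) (X y)) x := by
  congr 1; ext y; rw [real_inner_comm]

/-- The right-hand side of the Koszul formula for `⟨∇̂_X Y, Z⟩`. -/
def koszul (X Y Z : Π x : M, TangentSpace I x) (x : M) : ℝ :=
  (1 / 2 : ℝ) *
    (mvfderiv I (fun y ↦ inner ℝ (Y y) (Z y)) x (X x)
      + mvfderiv I (fun y ↦ inner ℝ (X y) (Z y)) x (Y x)
      - mvfderiv I (fun y ↦ inner ℝ (X y) (Y y)) x (Z x)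
      + inner ℝ (mlieBracket I X Y x) (Z x)
      - inner ℝ (mlieBracket I X Z x) (Y x)
      - inner ℝ (mlieBracket I Y Z x) (X x))

theorem koszul_tensorial_left {x : M} {Y Z : Π x : M, TangentSpace I x}
    (hY : MDiffAt (T% Y) x) (hZ : MDiffAt (T% Z) x) :
    TensorialAt I E (fun X ↦ koszul X Y Z x) x where
  smul {f X} hf hX := by
    simp only [koszul, mvfderiv_inner_smul hf hX hZ, mvfderiv_inner_smul hf hX hY,
      mlieBracket_smul_left hf hX]
    simp [inner_add_left, inner_smul_left, inner_smul_right]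
    ring
  add {X X'} hX hX' := by
    simp only [koszul, mvfderiv_inner_add hX hX' hZ, mvfderiv_inner_add hX hX' hY,
      mlieBracket_add_left hX hX']
    simp [inner_add_left, inner_add_right]
    ring

theorem koszul_tensorial_right {x : M} {X Y : Π x : M, TangentSpace I x}
    (hX : MDiffAt (T% X) x) (hY : MDiffAt (T% Y) x) :
    TensorialAt I E (fun Z ↦ koszul X Y Z x) x where
  smul {f Z} hf hZ := by
    simp only [koszul, mvfderiv_inner_comm _ _ (f • Z), mvfderiv_inner_smul hf hZ hX,
      mvfderiv_inner_smul hf hZ hY, mlieBracket_smul_right hf hZ]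
    simp only [mvfderiv_inner_comm _ Z]
    simp [inner_add_left, inner_smul_left, inner_smul_right, real_inner_comm]
    ring
  add {Z Z'} hZ hZ' := by
    simp only [koszul, mvfderiv_inner_comm _ _ (Z + Z'), mvfderiv_inner_add hZ hZ' hX,
      mvfderiv_inner_add hZ hZ' hY, mlieBracket_add_right hZ hZ']
    simp only [mvfderiv_inner_comm _ Z, mvfderiv_inner_comm _ Z']
    simp [inner_add_left, inner_add_right]
    ring

theorem koszul_add {x : M} {X Y Y' Z : Π x : M, TangentSpace I x}
    (hX : MDiffAt (T% X) x) (hY : MDiffAt (T% Y) x) (hY' : MDiffAt (T% Y') x)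
    (hZ : MDiffAt (T% Z) x) :
    koszul X (Y + Y') Z x = koszul X Y Z x + koszul X Y' Z x := by
  simp only [koszul, mvfderiv_inner_comm _ X (Y + Y'), mvfderiv_inner_add hY hY' hX,
    mvfderiv_inner_add hY hY' hZ, mlieBracket_add_right hY hY', mlieBracket_add_left hY hY']
  simp only [mvfderiv_inner_comm _ Y X, mvfderiv_inner_comm _ Y' X]
  simp [inner_add_left, inner_add_right]
  ring

theorem koszul_smul {x : M} {f : M → ℝ} {X Y Z : Π x : M, TangentSpace I x}
    (hf : MDiffAt f x) (hX : MDiffAt (T% X) x) (hY : MDiffAt (T% Y) x)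
    (hZ : MDiffAt (T% Z) x) :
    koszul X (f • Y) Z x
      = f x * koszul X Y Z x + mvfderiv I f x (X x) * inner ℝ (Y x) (Z x) := by
  simp only [koszul, mvfderiv_inner_comm _ X (f • Y), mvfderiv_inner_smul hf hY hX,
    mvfderiv_inner_smul hf hY hZ, mlieBracket_smul_right hf hY, mlieBracket_smul_left hf hY]
  simp only [mvfderiv_inner_comm _ Y X]
  simp [inner_add_left, inner_smul_left, inner_smul_right, real_inner_comm]
  ring

open scoped Classical in
/-- The bilinear form `(X, Z) ↦ ⟨∇̂_X Y, Z⟩` on `T_x M`, for `Y` differentiable at `x`. -/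
def koszulForm (Y : Π x : M, TangentSpace I x) (x : M) :
    TangentSpace I x →L[ℝ] TangentSpace I x →L[ℝ] ℝ :=
  if hY : MDiffAt (T% Y) x then
    TensorialAt.mkHom₂ (fun X Z ↦ koszul X Y Z x) x
      (fun _ hZ ↦ koszul_tensorial_left hY hZ) (fun _ hX ↦ koszul_tensorial_right hX hY)
  else 0

instance finiteDimensional_tangentSpace (x : M) : FiniteDimensional ℝ (TangentSpace I x) :=
  inferInstanceAs (FiniteDimensional ℝ E)

instance completeSpace_tangentSpace (x : M) : CompleteSpace (TangentSpace I x) :=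
  FiniteDimensional.complete ℝ _

theorem koszulForm_apply {x : M} {X Y Z : Π x : M, TangentSpace I x}
    (hX : MDiffAt (T% X) x) (hY : MDiffAt (T% Y) x) (hZ : MDiffAt (T% Z) x) :
    koszulForm Y x (X x) (Z x) = koszul X Y Z x := by
  rw [koszulForm, dif_pos hY]
  exact TensorialAt.mkHom₂_apply _ _ hX hZ

/-- The values of the Levi-Civita connection: `∇̂_v Y` at `x` is the vector representing
the linear form `koszulForm Y x v` through the metric. -/
def leviCivitaFun (Y : Π x : M, TangentSpace I x) (x : M) :
    TangentSpace I x →L[ℝ] TangentSpace I x :=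
  LinearMap.toContinuousLinearMap
    { toFun := fun v ↦ (InnerProductSpace.toDual ℝ (TangentSpace I x)).symm (koszulForm Y x v)
      map_add' := by intro v w; simp
      map_smul' := by intro c v; simp }

theorem inner_leviCivitaFun {x : M} {X Y Z : Π x : M, TangentSpace I x}
    (hX : MDiffAt (T% X) x) (hY : MDiffAt (T% Y) x) (hZ : MDiffAt (T% Z) x) :
    inner ℝ (leviCivitaFun Y x (X x)) (Z x) = koszul X Y Z x := by
  rw [← koszulForm_apply hX hY hZ]
  simp [leviCivitaFun]

theorem leviCivitaFun_ext {x : M} {L L' : TangentSpace I x →L[ℝ] TangentSpace I x}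
    (h : ∀ X Z : Π x : M, TangentSpace I x, MDiffAt (T% X) x → MDiffAt (T% Z) x →
      inner ℝ (L (X x)) (Z x) = inner ℝ (L' (X x)) (Z x)) : L = L' := by
  ext v
  refine ext_inner_right ℝ fun w ↦ ?_
  simpa using h (extend E v) (extend E w) (mdifferentiableAt_extend ..)
    (mdifferentiableAt_extend ..)

variable (I M) in
/-- The Levi-Civita connection `∇̂` of the Riemannian metric, given by the Koszul formula. -/
def leviCivita : CovariantDerivative I E (fun x : M ↦ TangentSpace I x) where
  toFun := leviCivitaFun
  isCovariantDerivativeOnUniv :=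
    { add := by
        intro Y Y' x hY hY' _
        refine leviCivitaFun_ext fun X Z hX hZ ↦ ?_
        rw [inner_leviCivitaFun hX (mdifferentiableAt_add_section hY hY') hZ,
          koszul_add hX hY hY' hZ, add_apply, inner_add_left,
          inner_leviCivitaFun hX hY hZ, inner_leviCivitaFun hX hY' hZ]
      leibniz := by
        intro Y f x hY hf _
        refine leviCivitaFun_ext fun X Z hX hZ ↦ ?_
        rw [inner_leviCivitaFun hX (hf.smul_section hY) hZ, koszul_smul hf hX hY hZ,
          add_apply, inner_add_left, smul_apply,
          real_inner_smul_left, inner_leviCivitaFun hX hY hZ,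
          ContinuousLinearMap.smulRight_apply, real_inner_smul_left] }

theorem inner_leviCivita {x : M} {X Y Z : Π x : M, TangentSpace I x}
    (hX : MDiffAt (T% X) x) (hY : MDiffAt (T% Y) x) (hZ : MDiffAt (T% Z) x) :
    inner ℝ (leviCivita I M Y x (X x)) (Z x) = koszul X Y Z x :=
  inner_leviCivitaFun hX hY hZ

theorem leviCivita_torsion : (leviCivita I M).torsion = 0 := by
  rw [CovariantDerivative.torsion_eq_zero_iff]
  intro X Y x hX hY
  refine ext_inner_right ℝ fun w ↦ ?_
  have hZ : MDiffAt (T% (extend E w)) x := mdifferentiableAt_extend ..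
  have h1 := inner_leviCivita hX hY hZ
  have h2 := inner_leviCivita hY hX hZ
  rw [extend_apply_self] at h1 h2
  rw [inner_sub_left, h1, h2]
  simp only [koszul, mvfderiv_inner_comm x Y X, extend_apply_self,
    mlieBracket_swap_apply (V := Y) (W := X), inner_neg_left]
  ring

variable (cov : CovariantDerivative I E (fun x : M ↦ TangentSpace I x))

/-- The covariant derivative of the metric, `(∇_u g)(v, w)`. -/
def nablaMetric (x : M) (u v w : TangentSpace I x) : ℝ :=
  CovariantDerivative.derivMetricTensor (I := I) (F := E)
    (V := fun x : M ↦ TangentSpace I x) (by exact cov) x v w u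

theorem nablaMetric_eq (x : M) (u v w : TangentSpace I x) :
    nablaMetric cov x u v w
      = mvfderiv I (fun y ↦ inner ℝ (extend E v y) (extend E w y)) x u
        - inner ℝ (cov (extend E v) x u) w - inner ℝ v (cov (extend E w) x u) := by
  have h := CovariantDerivative.derivMetricTensor_apply_eq_extend (I := I) (F := E)
    (V := fun x : M ↦ TangentSpace I x) (by exact cov) u v w
  unfold nablaMetric
  rw [h]

theorem nablaMetric_leviCivita (x : M) (u v w : TangentSpace I x) :
    nablaMetric (leviCivita I M) x u v w = 0 := by
  have hX : MDiffAt (T% (extend E u)) x := mdifferentiableAt_extend ..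
  have hY : MDiffAt (T% (extend E v)) x := mdifferentiableAt_extend ..
  have hZ : MDiffAt (T% (extend E w)) x := mdifferentiableAt_extend ..
  have h1 := inner_leviCivita hX hY hZ
  have h2 := inner_leviCivita hX hZ hY
  rw [extend_apply_self, extend_apply_self] at h1 h2
  rw [nablaMetric_eq, h1, real_inner_comm, h2]
  simp only [koszul, mvfderiv_inner_comm x (extend E w) (extend E v), extend_apply_self,
    mlieBracket_swap_apply (V := extend E w) (W := extend E v), inner_neg_left]
  ring

/-- The pair `(g, ∇)` is a statistical structure: `∇` is torsion-free and the cubic form `∇ g`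
is symmetric in all its arguments. -/
structure IsStatistical : Prop where
  torsion_eq_zero : cov.torsion = 0
  symm_left : ∀ (x : M) (u v w : TangentSpace I x),
    nablaMetric cov x u v w = nablaMetric cov x v u w
  symm_right : ∀ (x : M) (u v w : TangentSpace I x),
    nablaMetric cov x u v w = nablaMetric cov x u w v

/-- The difference tensor `K(u, v) = ∇_u v - ∇̂_u v`. -/
def differenceTensor (x : M) (u v : TangentSpace I x) : TangentSpace I x :=
  cov.difference (leviCivita I M) x v u

/-- The cubic form `A(u, v, w) = g(K(u, v), w)`. -/
def cubicForm (x : M) (u v w : TangentSpace I x) : ℝ :=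
  inner ℝ (differenceTensor cov x u v) w

/-- `(∇̂A)(u, a, b, c) = u(A(a, b, c)) - A(∇̂_u a, b, c) - A(a, ∇̂_u b, c) - A(a, b, ∇̂_u c)`,
where `a, b, c` are extended to vector fields near `x`, the choice being immaterial. -/
def nablaHatCubicForm (x : M) (u a b c : TangentSpace I x) : ℝ :=
  mvfderiv I (fun y ↦ cubicForm cov y (extend E a y) (extend E b y) (extend E c y)) x u
    - cubicForm cov x (leviCivita I M (extend E a) x u) b c
    - cubicForm cov x a (leviCivita I M (extend E b) x u) c
    - cubicForm cov x a b (leviCivita I M (extend E c) x u)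

/-- `∇̂A = 0`. -/
def HasParallelCubicForm : Prop :=
  ∀ (x : M) (u a b c : TangentSpace I x), nablaHatCubicForm cov x u a b c = 0

/-- `∇ = ∇̂`. The two are compared on the vector fields and at the points where the field is
differentiable; elsewhere the values of a `CovariantDerivative` are meaningless. -/
def IsTrivial : Prop :=
  ∀ (Y : Π x : M, TangentSpace I x) (x : M), MDiffAt (T% Y) x → cov Y x = leviCivita I M Y x

end Connections

section Geodesics

variable {E : Type*} [NormedAddCommGroup E] [NormedSpace ℝ E]
  {H : Type*} [TopologicalSpace H] {I : ModelWithCorners ℝ E H}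
  {M : Type*} [TopologicalSpace M] [ChartedSpace H M] [IsManifold I ∞ M]

variable (I) in
/-- The velocity vector of a curve. -/
def velocity (γ : ℝ → M) (t : ℝ) : TangentSpace I (γ t) :=
  mfderiv 𝓘(ℝ, ℝ) I γ t (1 : ℝ)

/-- The covariant derivative at `t` of a vector field `V` along the curve `γ`. In the local frame
near `γ t` given by the trivialization of the tangent bundle, `V = ∑ Vⁱ eᵢ` and
`∇_γ̇ V = ∑ (Vⁱ)' eᵢ + ∑ Vⁱ ∇_γ̇ eᵢ`; the first sum is the first summand below, and the second sum
is the covariant derivative of the field `∑ Vⁱ(t) eᵢ` with coefficients frozen at `t`, which is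
`extend E (V t)`. -/
def covDerivAlong (cov : CovariantDerivative I E (fun x : M ↦ TangentSpace I x))
    (γ : ℝ → M) (V : Π t : ℝ, TangentSpace I (γ t)) (t : ℝ) : TangentSpace I (γ t) :=
  (trivializationAt E (fun x : M ↦ TangentSpace I x) (γ t)).symm (γ t)
      (deriv (fun s ↦ (trivializationAt E (fun x : M ↦ TangentSpace I x) (γ t)
        ⟨γ s, V s⟩).2) t)
    + cov (extend E (V t)) (γ t) (velocity I γ t)

/-- `γ`, defined on the whole real line, is an affinely parametrized `∇`-geodesic. -/
structure IsGeodesic (cov : CovariantDerivative I E (fun x : M ↦ TangentSpace I x))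
    (γ : ℝ → M) : Prop where
  contMDiff : ContMDiff 𝓘(ℝ, ℝ) I ∞ γ
  covDerivAlong_velocity : ∀ t, covDerivAlong cov γ (velocity I γ) t = 0

/-- `∇` is geodesically complete: the geodesic with any given initial velocity is defined on the
whole real line. -/
def IsGeodesicallyComplete
    (cov : CovariantDerivative I E (fun x : M ↦ TangentSpace I x)) : Prop :=
  ∀ (x : M) (v : TangentSpace I x), ∃ γ : ℝ → M, IsGeodesic cov γ ∧
    (⟨γ 0, velocity I γ 0⟩ : TangentBundle I M) = ⟨x, v⟩

end Geodesics

section Hypersurfaces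

variable {n : ℕ} {M : Type*} [TopologicalSpace M] [ChartedSpace (EuclideanSpace ℝ (Fin n)) M]
  [IsManifold (𝓡 n) ∞ M]

/-- The volume form `ν_ξ(v₁, …, vₙ) = det (f_* v₁, …, f_* vₙ, ξ)` induced on `M` by the map `f`
and the transversal field `ξ`. -/
def inducedVolume (f ξ : M → EuclideanSpace ℝ (Fin (n + 1))) (x : M)
    (v : Fin n → TangentSpace (𝓡 n) x) : ℝ :=
  (EuclideanSpace.basisFun (Fin (n + 1)) ℝ).toBasis.det
    (Fin.snoc (α := fun _ ↦ EuclideanSpace ℝ (Fin (n + 1)))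
      (fun i ↦ mvfderiv (𝓡 n) f x (v i)) (ξ x))

/-- The metric `g` and the connection `∇` are those induced on `M` by the immersed hypersurface
`f : M → ℝⁿ⁺¹` endowed with the equiaffine transversal vector field `ξ`. As `g` is positive
definite, such a hypersurface is locally strongly convex. -/
structure IsInducedByEquiaffineHypersurface [RiemannianBundle (fun x : M ↦ TangentSpace (𝓡 n) x)]
    (f ξ : M → EuclideanSpace ℝ (Fin (n + 1)))
    (cov : CovariantDerivative (𝓡 n) (EuclideanSpace ℝ (Fin n))
      (fun x : M ↦ TangentSpace (𝓡 n) x)) : Prop where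
  contMDiff_immersion : ContMDiff (𝓡 n) 𝓘(ℝ, EuclideanSpace ℝ (Fin (n + 1))) ∞ f
  injective_mvfderiv : ∀ x, Function.Injective (mvfderiv (𝓡 n) f x)
  contMDiff_transversal : ContMDiff (𝓡 n) 𝓘(ℝ, EuclideanSpace ℝ (Fin (n + 1))) ∞ ξ
  transversal : ∀ x, IsCompl (mvfderiv (𝓡 n) f x).range (Submodule.span ℝ {ξ x})
  /-- The Gauss formula `D_u f_*Y = f_*(∇_u Y) + g(u, Y) ξ`. -/
  gauss : ∀ (Y : Π x : M, TangentSpace (𝓡 n) x) (x : M),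
    MDifferentiableAt (𝓡 n) ((𝓡 n).prod 𝓘(ℝ, EuclideanSpace ℝ (Fin n)))
      (fun y ↦ TotalSpace.mk' (EuclideanSpace ℝ (Fin n)) y (Y y)) x →
    ∀ u : TangentSpace (𝓡 n) x,
      mvfderiv (𝓡 n) (fun y ↦ mvfderiv (𝓡 n) f y (Y y)) x u
        = mvfderiv (𝓡 n) f x (cov Y x u) + (inner ℝ u (Y x) : ℝ) • ξ x
  /-- `∇ ν_ξ = 0`. -/
  equiaffine : ∀ (x : M) (u : TangentSpace (𝓡 n) x) (v : Fin n → TangentSpace (𝓡 n) x),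
    mvfderiv (𝓡 n)
        (fun y ↦ inducedVolume f ξ y (fun i ↦ extend (EuclideanSpace ℝ (Fin n)) (v i) y)) x u
      - ∑ i, inducedVolume f ξ x
          (Function.update v i (cov (extend (EuclideanSpace ℝ (Fin n)) (v i)) x u)) = 0

end Hypersurfaces

end StatGeom

end

/-! Along a `∇`-geodesic `γ` put `s = g(γ̇, γ̇)` and `φ = A(γ̇, γ̇, γ̇)`. Since `∇̂g = 0` and `∇ =
∇̂ + K`, one has `s' = (∇g)(γ̇, γ̇, γ̇) = -2φ`. The geodesic equation reads `∇̂_γ̇ γ̇ = -K(γ̇, γ̇)`,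
so by the total symmetry of `A`, `φ' = (∇̂A)(γ̇, γ̇, γ̇, γ̇) - 3q ≤ -3q` with `q = |K(γ̇, γ̇)|²`.
Cauchy–Schwarz gives `φ² ≤ q s`.

These relations form a Riccati-type inequality: if `φ 0 < 0`, the positive quantity `-s/φ` decreases
at speed at least 1 and reaches zero in finite time, which is impossible on a geodesic defined for
all time (`nonneg_of_riccati_system`). Hence completeness forces `A(v, v, v) ≥ 0` for every `v`. As
`A` is odd on the diagonal, it vanishes there, and polarization gives `K = 0`.

A parallel cubic form satisfies the inequality trivially. An equiaffine hypersurface induces a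
statistical structure: flatness of `D` and the Gauss formula give zero torsion, and the Codazzi
equation follows once equiaffinity has made the derivative of `ξ` tangential. -/

namespace StatGeom

open Filter Topology

/-! ### The Riccati inequality. -/

/-- A pair of functions with `s ≥ 0`, `s' = -2φ`, `φ' ≤ -3q` and `φ² ≤ q s` on the real line has
`φ 0 ≥ 0`: otherwise `-s / φ` would be positive with derivative at most `-1` on `[0, ∞)`. -/
theorem nonneg_of_riccati_system {s φ φ' q : ℝ → ℝ} (hs : ∀ t, HasDerivAt s (-2 * φ t) t)
    (hφ : ∀ t, HasDerivAt φ (φ' t) t) (hφ' : ∀ t, φ' t ≤ -3 * q t) (hs0 : ∀ t, 0 ≤ s t)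
    (hq : ∀ t, 0 ≤ q t) (hcs : ∀ t, φ t ^ 2 ≤ q t * s t) : 0 ≤ φ 0 := by
  by_contra! h0
  have hanti : Antitone φ := antitone_of_deriv_nonpos (fun t ↦ (hφ t).differentiableAt) fun t ↦ by
    rw [(hφ t).deriv]; linarith [hφ' t, hq t]
  have hneg : ∀ t, 0 ≤ t → φ t < 0 := fun t ht ↦ (hanti ht).trans_lt h0
  -- A zero of `s` would force `φ ^ 2 ≤ 0`.
  have hspos : ∀ t, 0 ≤ t → 0 < s t := fun t ht ↦ by
    refine lt_of_le_of_ne (hs0 t) fun h ↦ ?_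
    have := hcs t
    rw [← h, mul_zero] at this
    nlinarith [hneg t ht]
  have hw : ∀ t, 0 ≤ t → HasDerivAt (fun t ↦ t - s t / φ t)
      (1 - (-2 * φ t * φ t - s t * φ' t) / φ t ^ 2) t := fun t ht ↦
    (hasDerivAt_id t).sub ((hs t).div (hφ t) (hneg t ht).ne)
  -- The claim is `(s/φ)' ≥ 1`, and indeed `-2φ² - sφ' ≥ -2φ² + 3qs ≥ φ²`.
  have hw' : AntitoneOn (fun t ↦ t - s t / φ t) (Set.Ici 0) := by
    refine antitoneOn_of_deriv_nonpos (convex_Ici 0)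
      (fun t ht ↦ (hw t ht).continuousAt.continuousWithinAt)
      (fun t ht ↦ ?_) fun t ht ↦ ?_
    · rw [interior_Ici] at ht
      exact (hw t (le_of_lt ht)).differentiableAt.differentiableWithinAt
    · rw [interior_Ici] at ht
      rw [(hw t (le_of_lt ht)).deriv, sub_nonpos,
        le_div_iff₀ (sq_pos_of_neg (hneg t (le_of_lt ht)))]
      nlinarith [hcs t, hφ' t, hspos t (le_of_lt ht)]
  -- By time `T` the positive quantity `-s/φ`, starting at `T` and losing at least one unit per unit
  -- of time, would have reached zero.
  set T := -(s 0 / φ 0) with hT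
  have hT0 : 0 ≤ T := by
    rw [hT, ← div_neg]
    exact div_nonneg (hs0 0) (by linarith)
  have h := hw' (Set.mem_Ici.2 le_rfl) (Set.mem_Ici.2 hT0) hT0
  have hpos : s T / φ T < 0 := div_neg_of_pos_of_neg (hspos T hT0) (hneg T hT0)
  simp only [zero_sub] at h
  linarith

/-! ### Product rule for families of linear maps. -/

section Linear

variable {E F : Type*} [NormedAddCommGroup E] [NormedSpace ℝ E] [FiniteDimensional ℝ E]
  [NormedAddCommGroup F] [NormedSpace ℝ F]

/-- The product rule for a pointwise differentiable family of linear maps on a finite-dimensional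
space applied to a differentiable curve. -/
theorem hasDerivAt_isLinearMap_apply {L : ℝ → E → F} {L' : E → F} {v : ℝ → E} {v' : E}
    {t : ℝ} (hlin : ∀ᶠ s in 𝓝 t, IsLinearMap ℝ (L s))
    (hL : ∀ a, HasDerivAt (fun s ↦ L s a) (L' a) t) (hv : HasDerivAt v v' t) :
    HasDerivAt (fun s ↦ L s (v s)) (L' (v t) + L t v') t := by
  let b := Module.finBasis ℝ E
  have hc : ∀ i, HasDerivAt (fun s ↦ b.repr (v s) i) (b.repr v' i) t := fun i ↦
    ((LinearMap.toContinuousLinearMap (b.coord i)).hasFDerivAt.comp_hasDerivAt t hv)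
  have h := HasDerivAt.fun_sum (u := Finset.univ) fun i _ ↦ (hc i).smul (hL (b i))
  have key : ∀ᶠ s in 𝓝 t, ∀ x, L s x = ∑ i, b.repr x i • L s (b i) := by
    filter_upwards [hlin] with s hs x
    conv_lhs => rw [← b.sum_repr x, ← hs.mk'_apply, map_sum]
    simp
  -- `L'` is not assumed linear; its expansion in the basis comes from uniqueness of derivatives.
  have e2 : L' (v t) = ∑ i, b.repr (v t) i • L' (b i) := by
    have h' := HasDerivAt.fun_sum (u := Finset.univ) fun i _ ↦
      (hL (b i)).const_smul (b.repr (v t) i)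
    exact (hL (v t)).unique (h'.congr_of_eventuallyEq (key.mono fun s hs ↦ by simpa using hs (v t)))
  rw [e2, key.self_of_nhds v', ← Finset.sum_add_distrib]
  exact h.congr_of_eventuallyEq (key.mono fun s hs ↦ by simpa using hs (v s))

end Linear

/-! ### Smoothness of the connection terms and of the cubic form. -/

section Smoothness

variable {E : Type*} [NormedAddCommGroup E] [NormedSpace ℝ E]
  {H : Type*} [TopologicalSpace H] {I : ModelWithCorners ℝ E H}
  {M : Type*} [TopologicalSpace M] [ChartedSpace H M] [IsManifold I ∞ M]
  {F : Type*} [NormedAddCommGroup F] [NormedSpace ℝ F]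

/-- The derivative of a vector-valued function along a vector field depends smoothly on the
point. -/
theorem contMDiffAt_mvfderiv_apply {m n : WithTop ℕ∞} {h : M → F}
    {X : Π x : M, TangentSpace I x} {x : M} (hh : ContMDiffAt I 𝓘(ℝ, F) n h x)
    (hX : ContMDiffAt I I.tangent m (T% X) x) (hmn : m + 1 ≤ n) :
    ContMDiffAt I 𝓘(ℝ, F) m (fun y ↦ mvfderiv I h y (X y)) x := by
  have h1 := hh.mfderiv_const hmn
  have h2 := ContMDiffAt.clm_apply_of_inCoordinates h1 hX
    (hh.of_le (le_self_add.trans hmn))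
  exact (contMDiff_snd_tangentBundle_modelSpace F 𝓘(ℝ, F)).contMDiffAt.comp x h2

/-- Smoothness of `cov` speaks of globally smooth fields. Multiplying `Y` by a bump function
supported where `Y` is smooth produces such a field, and locality of `cov` brings the result back to
`Y` near `x`. -/
theorem contMDiffAt_covariantDerivative [FiniteDimensional ℝ E] [T2Space M]
    {cov : CovariantDerivative I E (fun x : M ↦ TangentSpace I x)}
    (hcov : cov.ContMDiffCovariantDerivative ∞) {X Y : Π x : M, TangentSpace I x} {x : M}
    (hX : ContMDiffAt I I.tangent ∞ (T% X) x)
    (hY : ∀ᶠ y in 𝓝 x, ContMDiffAt I I.tangent ∞ (T% Y) y) :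
    ContMDiffAt I I.tangent ∞ (T% (fun y ↦ cov Y y (X y))) x := by
  obtain ⟨f, -, hf⟩ := (SmoothBumpFunction.nhds_basis_tsupport (I := I) x).mem_iff.1
    (isOpen_interior.mem_nhds (mem_interior_iff_mem_nhds.2 hY))
  have hfY : ContMDiff I I.tangent ∞ (T% ((f : M → ℝ) • Y)) :=
    ContMDiffOn.smul_section_of_tsupport f.contMDiff.contMDiffOn isOpen_interior hf
      fun y hy ↦ ContMDiffAt.contMDiffWithinAt
        (interior_subset hy : ContMDiffAt I I.tangent ∞ (T% Y) y)
  have h1 := (hcov.contMDiff.contMDiff (by simpa using hfY.contMDiffOn)).contMDiffAt univ_mem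
    (x := x)
  refine (h1.clm_bundle_apply hX).congr_of_eventuallyEq ?_
  filter_upwards [hY, f.eventuallyEq_one.eventuallyEq_nhds] with y hy hfy
  have := cov.isCovariantDerivativeOnUniv.congr_of_eventuallyEq
    (hy.mdifferentiableAt (by simp)) (hfY.contMDiffAt.mdifferentiableAt (by simp)) univ_mem
    (hfy.mono fun z hz ↦ by simp [hz])
  simp only [this]
  rfl

variable [FiniteDimensional ℝ E]
  [RiemannianBundle (fun x : M ↦ TangentSpace I x)]
  [IsContMDiffRiemannianBundle I ∞ E (fun x : M ↦ TangentSpace I x)]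

theorem contMDiffAt_inner {m : WithTop ℕ∞} [ENat.LEInfty m] {X Y : Π x : M, TangentSpace I x} {x : M}
    (hX : ContMDiffAt I I.tangent m (T% X) x) (hY : ContMDiffAt I I.tangent m (T% Y) x) :
    ContMDiffAt I 𝓘(ℝ, ℝ) m (fun y ↦ (inner ℝ (X y) (Y y) : ℝ)) x :=
  ContMDiffAt.inner_bundle (E := fun x : M ↦ TangentSpace I x) (F := E) hX hY

theorem contMDiffAt_koszul {X Y Z : Π x : M, TangentSpace I x} {x : M}
    (hX : ContMDiffAt I I.tangent ∞ (T% X) x) (hY : ContMDiffAt I I.tangent ∞ (T% Y) x)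
    (hZ : ContMDiffAt I I.tangent ∞ (T% Z) x) :
    ContMDiffAt I 𝓘(ℝ, ℝ) ∞ (koszul X Y Z) x := by
  have : IsManifold I (minSmoothness ℝ 2) M := by
    rw [minSmoothness_of_isRCLikeNormedField]; infer_instance
  have : IsManifold I (((⊤ : ℕ∞) : WithTop ℕ∞) + 1) M := inferInstanceAs (IsManifold I ∞ M)
  have hd : ∀ {X Y Z : Π x : M, TangentSpace I x}, ContMDiffAt I I.tangent ∞ (T% X) x →
      ContMDiffAt I I.tangent ∞ (T% Y) x → ContMDiffAt I I.tangent ∞ (T% Z) x →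
      ContMDiffAt I 𝓘(ℝ, ℝ) ∞ (fun y ↦ mvfderiv I (fun y ↦ inner ℝ (X y) (Y y)) y (Z y)) x :=
    fun hX hY hZ ↦ contMDiffAt_mvfderiv_apply (contMDiffAt_inner hX hY) hZ le_rfl
  have hb : ∀ {X Y Z : Π x : M, TangentSpace I x}, ContMDiffAt I I.tangent ∞ (T% X) x →
      ContMDiffAt I I.tangent ∞ (T% Y) x → ContMDiffAt I I.tangent ∞ (T% Z) x →
      ContMDiffAt I 𝓘(ℝ, ℝ) ∞ (fun y ↦ inner ℝ (mlieBracket I X Y y) (Z y)) x :=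
    fun hX hY hZ ↦ contMDiffAt_inner
      (ContMDiffAt.mlieBracket_vectorField (n := ⊤) (m := ⊤) hX hY
        (by rw [minSmoothness_of_isRCLikeNormedField]; exact le_rfl)) hZ
  exact contMDiffAt_const.mul ((((((hd hY hZ hX).add (hd hX hZ hY)).sub (hd hX hY hZ)).add
    (hb hX hY hZ)).sub (hb hX hZ hY)).sub (hb hY hZ hX))

theorem mdifferentiableAt_of_contMDiffAt {X : Π x : M, TangentSpace I x} {x : M}
    (hX : ContMDiffAt I I.tangent ∞ (T% X) x) : MDiffAt (T% X) x :=
  hX.mdifferentiableAt (by simp)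

theorem eventually_contMDiffAt_extend {x : M} (v : TangentSpace I x) :
    ∀ᶠ y in 𝓝 x, ContMDiffAt I I.tangent ∞ (T% (extend E v)) y := by
  obtain ⟨s, hs, h⟩ := exists_contMDiffOn_extend (k := ∞) I E v
  filter_upwards [eventually_mem_nhds_iff.2 hs] with y hy using h.contMDiffAt hy

variable (cov : CovariantDerivative I E (fun x : M ↦ TangentSpace I x))

theorem differenceTensor_apply {Y : Π x : M, TangentSpace I x} {x : M} (hY : MDiffAt (T% Y) x)
    (u : TangentSpace I x) :
    differenceTensor cov x u (Y x) = cov Y x u - leviCivita I M Y x u := by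
  have h := IsCovariantDerivativeOn.difference_apply (hcov := cov.isCovariantDerivativeOn)
    (hcov' := (leviCivita I M).isCovariantDerivativeOn) (hx := Set.mem_univ x) hY
  exact congr($h u)

theorem cubicForm_apply {X Y Z : Π x : M, TangentSpace I x} {x : M} (hX : MDiffAt (T% X) x)
    (hY : MDiffAt (T% Y) x) (hZ : MDiffAt (T% Z) x) :
    cubicForm cov x (X x) (Y x) (Z x)
      = inner ℝ (cov Y x (X x)) (Z x) - koszul X Y Z x := by
  rw [cubicForm, differenceTensor_apply cov hY, inner_sub_left, inner_leviCivita hX hY hZ]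

/-- Pairing with `Z` turns the Levi-Civita term into the Koszul expression, so smoothness of `∇̂`
itself is never needed. -/
theorem contMDiffAt_cubicForm [T2Space M] {cov} (hcov : cov.ContMDiffCovariantDerivative ∞)
    {X Y Z : Π x : M, TangentSpace I x} {x : M}
    (hX : ∀ᶠ y in 𝓝 x, ContMDiffAt I I.tangent ∞ (T% X) y)
    (hY : ∀ᶠ y in 𝓝 x, ContMDiffAt I I.tangent ∞ (T% Y) y)
    (hZ : ∀ᶠ y in 𝓝 x, ContMDiffAt I I.tangent ∞ (T% Z) y) :
    ContMDiffAt I 𝓘(ℝ, ℝ) ∞ (fun y ↦ cubicForm cov y (X y) (Y y) (Z y)) x := by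
  have h := (contMDiffAt_inner (contMDiffAt_covariantDerivative hcov hX.self_of_nhds hY)
    hZ.self_of_nhds).sub (contMDiffAt_koszul hX.self_of_nhds hY.self_of_nhds hZ.self_of_nhds)
  refine h.congr_of_eventuallyEq ?_
  filter_upwards [hX, hY, hZ] with y h1 h2 h3
  exact cubicForm_apply cov (mdifferentiableAt_of_contMDiffAt h1)
    (mdifferentiableAt_of_contMDiffAt h2) (mdifferentiableAt_of_contMDiffAt h3)

end Smoothness

/-! ### Curves, frame fields and the geodesic equation. -/

section Curves

variable {E : Type*} [NormedAddCommGroup E] [NormedSpace ℝ E]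
  {H : Type*} [TopologicalSpace H] {I : ModelWithCorners ℝ E H}
  {M : Type*} [TopologicalSpace M] [ChartedSpace H M] [IsManifold I ∞ M]

theorem contMDiff_velocity {γ : ℝ → M} (hγ : ContMDiff 𝓘(ℝ, ℝ) I ∞ γ) :
    ContMDiff 𝓘(ℝ, ℝ) I.tangent ∞ (fun t ↦ (⟨γ t, velocity I γ t⟩ : TangentBundle I M)) := by
  have h1 : ContMDiff 𝓘(ℝ, ℝ) 𝓘(ℝ, ℝ).tangent ∞
      (fun t : ℝ ↦ (⟨t, (1 : ℝ)⟩ : TangentBundle 𝓘(ℝ, ℝ) ℝ)) :=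
    contMDiff_vectorSpace_iff_contDiff.2 contDiff_const
  exact (hγ.contMDiff_tangentMap le_rfl).comp h1

theorem hasDerivAt_comp_curve {γ : ℝ → M} (hγ : ContMDiff 𝓘(ℝ, ℝ) I ∞ γ) {t : ℝ} {h : M → ℝ}
    (hh : MDiffAt h (γ t)) :
    HasDerivAt (fun s ↦ h (γ s)) (mvfderiv I h (γ t) (velocity I γ t)) t := by
  have h1 := (hh.hasMFDerivAt.comp t (hγ.contMDiffAt.mdifferentiableAt (by simp)).hasMFDerivAt)
  have h2 : HasFDerivAt (fun s ↦ h (γ s)) (show ℝ →L[ℝ] ℝ from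
      (mvfderiv I h (γ t)).comp (mfderiv 𝓘(ℝ, ℝ) I γ t)) t := hasMFDerivAt_iff_hasFDerivAt.1 h1
  exact h2.hasDerivAt

/-- The local frame field with constant coefficients `a` in the trivialization of the tangent
bundle at `x`. -/
noncomputable def frameField (x : M) (a : E) (y : M) : TangentSpace I y :=
  (trivializationAt E (fun x : M ↦ TangentSpace I x) x).symm y a

theorem isLinearMap_frameField {x y : M}
    (hy : y ∈ (trivializationAt E (fun x : M ↦ TangentSpace I x) x).baseSet) :
    IsLinearMap ℝ (fun a : E ↦ frameField (I := I) x a y) := by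
  convert! ((trivializationAt E (fun x : M ↦ TangentSpace I x) x).symmₗ ℝ y).isLinear using 2 with a
  exact (Trivialization.symmₗ_apply _ hy a).symm

theorem extend_eq_frameField {x : M} (v : TangentSpace I x) :
    extend E v = frameField x
      (trivializationAt E (fun x : M ↦ TangentSpace I x) x ⟨x, v⟩).2 := rfl

/-- Lets facts about `extend` apply to fields with arbitrary constant coefficients. -/
theorem frameField_eq_extend (x : M) (a : E) :
    frameField (I := I) x a = extend E (frameField (I := I) x a x) := by
  rw [extend_eq_frameField]
  exact congrArg (frameField x) (congrArg Prod.snd (Trivialization.apply_mk_symm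
    (trivializationAt E (fun x : M ↦ TangentSpace I x) x)
    (mem_baseSet_trivializationAt' x) a)).symm

/-- The components of the velocity in the trivialization of the tangent bundle at `γ t`. -/
noncomputable def velocityComponents (I : ModelWithCorners ℝ E H) {M : Type*} [TopologicalSpace M]
    [ChartedSpace H M] [IsManifold I ∞ M] (γ : ℝ → M) (t s : ℝ) : E :=
  (trivializationAt E (fun x : M ↦ TangentSpace I x) (γ t) ⟨γ s, velocity I γ s⟩).2

theorem hasDerivAt_velocityComponents {γ : ℝ → M} (hγ : ContMDiff 𝓘(ℝ, ℝ) I ∞ γ) (t : ℝ) :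
    HasDerivAt (velocityComponents I γ t) (deriv (velocityComponents I γ t) t) t := by
  have h := (contMDiffAt_totalSpace.1 ((contMDiff_velocity hγ).contMDiffAt (x := t))).2
  exact ((contMDiffAt_iff_contDiffAt.1 h).differentiableAt (by simp)).hasDerivAt

theorem eventually_velocity_eq_frameField {γ : ℝ → M} (hγ : Continuous γ) (t : ℝ) :
    ∀ᶠ s in 𝓝 t, velocity I γ s = frameField (γ t) (velocityComponents I γ t s) (γ s) := by
  filter_upwards [hγ.continuousAt.eventually_mem
    ((trivializationAt E (fun x : M ↦ TangentSpace I x) (γ t)).open_baseSet.mem_nhds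
      (mem_baseSet_trivializationAt' (γ t)))] with s hs
  exact (Trivialization.symm_apply_apply_mk _ hs _).symm

/-- The geodesic equation in the form in which the product rule along `γ` consumes it. -/
theorem IsGeodesic.frameField_deriv {cov : CovariantDerivative I E (fun x : M ↦ TangentSpace I x)}
    {γ : ℝ → M} (hγ : IsGeodesic cov γ) (t : ℝ) :
    frameField (γ t) (deriv (velocityComponents I γ t) t) (γ t)
      = - cov (extend E (velocity I γ t)) (γ t) (velocity I γ t) :=
  eq_neg_of_add_eq_zero_left (hγ.covDerivAlong_velocity t)

end Curves

/-! ### Symmetries of the cubic form and its evolution along geodesics. -/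

section Geodesics

variable {E : Type*} [NormedAddCommGroup E] [NormedSpace ℝ E] [FiniteDimensional ℝ E]
  {H : Type*} [TopologicalSpace H] {I : ModelWithCorners ℝ E H}
  {M : Type*} [TopologicalSpace M] [ChartedSpace H M] [IsManifold I ∞ M]
  [RiemannianBundle (fun x : M ↦ TangentSpace I x)]
  [IsContMDiffRiemannianBundle I ∞ E (fun x : M ↦ TangentSpace I x)]
  {cov : CovariantDerivative I E (fun x : M ↦ TangentSpace I x)}

theorem isLinearMap_cubicForm_left (x : M) (v w : TangentSpace I x) :
    IsLinearMap ℝ (fun u ↦ cubicForm cov x u v w) :=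
  ⟨fun u u' ↦ by simp [cubicForm, differenceTensor, inner_add_left],
    fun c u ↦ by simp [cubicForm, differenceTensor, real_inner_smul_left]⟩

theorem isLinearMap_cubicForm_middle (x : M) (u w : TangentSpace I x) :
    IsLinearMap ℝ (fun v ↦ cubicForm cov x u v w) :=
  ⟨fun u u' ↦ by simp [cubicForm, differenceTensor, inner_add_left],
    fun c u ↦ by simp [cubicForm, differenceTensor, real_inner_smul_left]⟩

theorem isLinearMap_cubicForm_right (x : M) (u v : TangentSpace I x) :
    IsLinearMap ℝ (fun w ↦ cubicForm cov x u v w) :=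
  ⟨fun u u' ↦ by simp [cubicForm, inner_add_right],
    fun c u ↦ by simp [cubicForm, real_inner_smul_right]⟩

theorem differenceTensor_eq_extend (x : M) (u v : TangentSpace I x) :
    differenceTensor cov x u v = cov (extend E v) x u - leviCivita I M (extend E v) x u := by
  simpa using differenceTensor_apply cov (mdifferentiableAt_extend I E v) u

/-- Because `∇̂g = 0`, only the difference `K` contributes to `∇g`. -/
theorem nablaMetric_eq_cubicForm (x : M) (u v w : TangentSpace I x) :
    nablaMetric cov x u v w = - cubicForm cov x u v w - cubicForm cov x u w v := by
  have h := nablaMetric_leviCivita (I := I) x u v w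
  rw [nablaMetric_eq] at h ⊢
  simp only [cubicForm, differenceTensor_eq_extend, inner_sub_left]
  rw [real_inner_comm v, real_inner_comm v] at *
  linarith

theorem IsStatistical.differenceTensor_comm (h : IsStatistical cov) (x : M)
    (u v : TangentSpace I x) : differenceTensor cov x u v = differenceTensor cov x v u := by
  have h1 := cov.torsion_eq_zero_iff.1 h.torsion_eq_zero (mdifferentiableAt_extend I E u)
    (mdifferentiableAt_extend I E v)
  have h2 := (leviCivita I M).torsion_eq_zero_iff.1 leviCivita_torsion
    (mdifferentiableAt_extend I E u) (mdifferentiableAt_extend I E v)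
  simp only [extend_apply_self] at h1 h2
  rw [differenceTensor_eq_extend, differenceTensor_eq_extend, ← sub_eq_zero]
  rw [← h2, ← sub_eq_zero] at h1
  rw [← h1]
  abel

theorem IsStatistical.cubicForm_swap_left (h : IsStatistical cov) (x : M)
    (u v w : TangentSpace I x) : cubicForm cov x u v w = cubicForm cov x v u w := by
  rw [cubicForm, h.differenceTensor_comm, cubicForm]

/-- Writing both sides of the Codazzi symmetry of `∇g` through `A`, one term cancels by the symmetry
of `K` and the other is the claim. -/
theorem IsStatistical.cubicForm_swap_right (h : IsStatistical cov) (x : M)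
    (u v w : TangentSpace I x) : cubicForm cov x u v w = cubicForm cov x u w v := by
  have h1 := h.symm_left x v w u
  rw [nablaMetric_eq_cubicForm, nablaMetric_eq_cubicForm] at h1
  linarith [h.cubicForm_swap_left x v w u, h.cubicForm_swap_left x u v w,
    h.cubicForm_swap_left x u w v]

theorem sq_cubicForm_diag_le (x : M) (u : TangentSpace I x) :
    cubicForm cov x u u u ^ 2 ≤ ‖differenceTensor cov x u u‖ ^ 2 * inner ℝ u u := by
  rw [real_inner_self_eq_norm_sq, ← mul_pow]
  exact sq_le_sq' (neg_le_of_abs_le (abs_real_inner_le_norm _ _)) (real_inner_le_norm _ _)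

theorem cubicForm_differenceTensor_right (x : M) (u : TangentSpace I x) :
    cubicForm cov x u u (differenceTensor cov x u u) = ‖differenceTensor cov x u u‖ ^ 2 :=
  real_inner_self_eq_norm_sq _

/-- The source of the constant 3 in the Riccati system: by total symmetry the three terms agree. -/
theorem IsStatistical.cubicForm_differenceTensor_sum (h : IsStatistical cov) (x : M)
    (u : TangentSpace I x) :
    cubicForm cov x (differenceTensor cov x u u) u u
      + cubicForm cov x u (differenceTensor cov x u u) u
      + cubicForm cov x u u (differenceTensor cov x u u)
      = 3 * ‖differenceTensor cov x u u‖ ^ 2 := by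
  rw [h.cubicForm_swap_left x (differenceTensor cov x u u) u u,
    h.cubicForm_swap_right x u (differenceTensor cov x u u) u, cubicForm_differenceTensor_right]
  ring

theorem isTrivial_of_cubicForm_diag (h : IsStatistical cov)
    (h0 : ∀ (x : M) (u : TangentSpace I x), cubicForm cov x u u u = 0) : IsTrivial cov := by
  intro Y x hY
  have h1 : ∀ u v : TangentSpace I x, cubicForm cov x u u v = 0 := fun u v ↦ by
    -- The two expansions are `±3A(u,u,v) + 3A(u,v,v) = 0`; their difference isolates `A(u,u,v)`.
    have e1 := h0 x (u + v)
    have e2 := h0 x (u - v)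
    simp only [(isLinearMap_cubicForm_left x _ _).map_add,
      (isLinearMap_cubicForm_middle x _ _).map_add, (isLinearMap_cubicForm_right x _ _).map_add,
      (isLinearMap_cubicForm_left x _ _).map_sub, (isLinearMap_cubicForm_middle x _ _).map_sub,
      (isLinearMap_cubicForm_right x _ _).map_sub, h0, h.cubicForm_swap_left x v u,
      h.cubicForm_swap_right x u v u, h.cubicForm_swap_right x v v u] at e1 e2
    linarith
  have h2 : ∀ u v w : TangentSpace I x, cubicForm cov x u v w = 0 := fun u v w ↦ by
    have e := h1 (u + v) w
    simp only [(isLinearMap_cubicForm_left x _ _).map_add,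
      (isLinearMap_cubicForm_middle x _ _).map_add, h1, h.cubicForm_swap_left x v u] at e
    linarith
  ext u
  rw [← sub_eq_zero, ← differenceTensor_apply cov hY]
  exact inner_self_eq_zero (𝕜 := ℝ).1 (h2 _ _ _)

/-- Needed because a `∇`-geodesic need not have constant `g`-speed, whereas the hypothesis concerns
unit vectors only. -/
theorem nablaHatCubicForm_smul [T2Space M] (hcov : cov.ContMDiffCovariantDerivative ∞) (c : ℝ)
    (x : M) (u : TangentSpace I x) :
    nablaHatCubicForm cov x (c • u) (c • u) (c • u) (c • u)
      = c ^ 4 * nablaHatCubicForm cov x u u u u := by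
  have he := eventually_contMDiffAt_extend u
  have hd : MDiffAt (fun y ↦ cubicForm cov y (extend E u y) (extend E u y) (extend E u y)) x :=
    (contMDiffAt_cubicForm hcov he he he).mdifferentiableAt (by simp)
  -- Linearity of the extension is available on the base set of the trivialization, hence only near
  -- `x`.
  have hs : ∀ᶠ y in 𝓝 x, extend E (c • u) y = (c • extend E u) y := by
    filter_upwards [(trivializationAt E (fun x : M ↦ TangentSpace I x) x).open_baseSet.mem_nhds
      (mem_baseSet_trivializationAt' x)] with y hy
    have h1 := (isLinearMap_frameField hy).map_smul c
      (trivializationAt E (fun x : M ↦ TangentSpace I x) x ⟨x, u⟩).2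
    rw [Pi.smul_apply, extend_eq_frameField, extend_eq_frameField, ← h1,
      ((trivializationAt E (fun x : M ↦ TangentSpace I x) x).linear ℝ
        (mem_baseSet_trivializationAt' x)).map_smul]
  have hm : mvfderiv I (fun y ↦ cubicForm cov y (extend E (c • u) y) (extend E (c • u) y)
      (extend E (c • u) y)) x = c ^ 3 • mvfderiv I (fun y ↦ cubicForm cov y (extend E u y)
        (extend E u y) (extend E u y)) x := by
    have h1 := mvfderiv_fun_mul (mdifferentiableAt_const (c := c ^ 3) (I := I) (x := x)) hd
    rw [mvfderiv_const, smul_zero, add_zero] at h1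
    rw [← h1]
    refine congrArg (_ ∘L ·) (Filter.EventuallyEq.mfderiv_eq ?_)
    filter_upwards [hs] with y hy
    simp only [hy, Pi.smul_apply, (isLinearMap_cubicForm_left y _ _).map_smul,
      (isLinearMap_cubicForm_middle y _ _).map_smul, (isLinearMap_cubicForm_right y _ _).map_smul,
      smul_eq_mul]
    ring
  have hl : leviCivita I M (extend E (c • u)) x = c • leviCivita I M (extend E u) x := by
    rw [← (leviCivita I M).isCovariantDerivativeOnUniv.smul_const c
      (mdifferentiableAt_extend I E u)]
    exact (leviCivita I M).isCovariantDerivativeOnUniv.congr_of_eventuallyEq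
      (mdifferentiableAt_extend I E _)
      (mdifferentiableAt_const.smul_section (mdifferentiableAt_extend I E u)) univ_mem hs
  rw [nablaHatCubicForm, hm, hl]
  simp only [nablaHatCubicForm, (isLinearMap_cubicForm_left x _ _).map_smul,
      (isLinearMap_cubicForm_middle x _ _).map_smul, (isLinearMap_cubicForm_right x _ _).map_smul,
      smul_apply, map_smul, smul_eq_mul]
  ring

theorem nablaHatCubicForm_nonpos [T2Space M] (hcov : cov.ContMDiffCovariantDerivative ∞)
    (h : ∀ (x : M) (u : TangentSpace I x), ‖u‖ = 1 → nablaHatCubicForm cov x u u u u ≤ 0)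
    (x : M) (u : TangentSpace I x) : nablaHatCubicForm cov x u u u u ≤ 0 := by
  by_cases hu : u = 0
  · have := nablaHatCubicForm_smul hcov 0 x u
    rw [zero_smul, zero_pow (by norm_num), zero_mul] at this
    rw [hu]
    exact this.le
  · have hn : ‖u‖ ≠ 0 := norm_ne_zero_iff.2 hu
    have h1 := h x (‖u‖⁻¹ • u) (by rw [norm_smul, norm_inv, norm_norm, inv_mul_cancel₀ hn])
    rw [nablaHatCubicForm_smul hcov] at h1
    exact nonpos_of_mul_nonpos_right h1 (by positivity)

/-- The derivative of `g(γ̇, γ̇)` along a `∇`-geodesic `γ`. -/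
theorem IsGeodesic.hasDerivAt_norm_sq {γ : ℝ → M} (hγ : IsGeodesic cov γ) (t : ℝ) :
    HasDerivAt (fun t ↦ (inner ℝ (velocity I γ t) (velocity I γ t) : ℝ))
      (nablaMetric cov (γ t) (velocity I γ t) (velocity I γ t) (velocity I γ t)) t := by
  have hv := hasDerivAt_velocityComponents hγ.contMDiff t
  have hlin := (hγ.contMDiff.continuous.continuousAt (x := t)).eventually_mem
    ((trivializationAt E (fun x : M ↦ TangentSpace I x) (γ t)).open_baseSet.mem_nhds
      (mem_baseSet_trivializationAt' (γ t)))
  have h0 : ∀ a b : E, HasDerivAt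
      (fun s ↦ (inner ℝ (frameField (I := I) (γ t) a (γ s)) (frameField (γ t) b (γ s)) : ℝ))
      (mvfderiv I (fun y ↦ inner ℝ (frameField (γ t) a y) (frameField (γ t) b y)) (γ t)
        (velocity I γ t)) t := fun a b ↦ by
    refine hasDerivAt_comp_curve hγ.contMDiff (mdifferentiableAt_inner ?_ ?_) <;>
    · rw [frameField_eq_extend]
      exact mdifferentiableAt_extend I E _
  -- The constant coefficients are replaced by the velocity components one slot at a time.
  have h1 := fun b ↦ hasDerivAt_isLinearMap_apply (hlin.mono fun s hs ↦
    ⟨fun a a' ↦ by rw [(isLinearMap_frameField hs).map_add, inner_add_left],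
      fun c a ↦ by rw [(isLinearMap_frameField hs).map_smul, real_inner_smul_left, smul_eq_mul]⟩)
    (fun a ↦ h0 a b) hv
  have h2 := hasDerivAt_isLinearMap_apply (hlin.mono fun s hs ↦
    ⟨fun a a' ↦ by rw [(isLinearMap_frameField hs).map_add, inner_add_right],
      fun c a ↦ by rw [(isLinearMap_frameField hs).map_smul, real_inner_smul_right, smul_eq_mul]⟩)
    h1 hv
  have hvt := (eventually_velocity_eq_frameField (I := I) hγ.contMDiff.continuous t)
  refine (h2.congr_of_eventuallyEq (hvt.mono fun s hs ↦ by simp only [← hs])).congr_deriv ?_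
  rw [hγ.frameField_deriv, ← hvt.self_of_nhds, nablaMetric_eq]
  simp only [velocityComponents, ← extend_eq_frameField, inner_neg_left, inner_neg_right]
  ring

/-- The derivative of `A(γ̇, γ̇, γ̇)` along a `∇`-geodesic `γ`, on which `∇̂_γ̇ γ̇ = -K(γ̇, γ̇)`. -/
theorem IsGeodesic.hasDerivAt_cubicForm [T2Space M] (hcov : cov.ContMDiffCovariantDerivative ∞)
    {γ : ℝ → M} (hγ : IsGeodesic cov γ) (t : ℝ) :
    HasDerivAt (fun t ↦ cubicForm cov (γ t) (velocity I γ t) (velocity I γ t) (velocity I γ t))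
      (nablaHatCubicForm cov (γ t) (velocity I γ t) (velocity I γ t) (velocity I γ t)
          (velocity I γ t)
        - (cubicForm cov (γ t) (differenceTensor cov (γ t) (velocity I γ t) (velocity I γ t))
            (velocity I γ t) (velocity I γ t)
          + cubicForm cov (γ t) (velocity I γ t)
            (differenceTensor cov (γ t) (velocity I γ t) (velocity I γ t)) (velocity I γ t)
          + cubicForm cov (γ t) (velocity I γ t) (velocity I γ t)
            (differenceTensor cov (γ t) (velocity I γ t) (velocity I γ t)))) t := by
  have hv := hasDerivAt_velocityComponents hγ.contMDiff t
  have hlin := (hγ.contMDiff.continuous.continuousAt (x := t)).eventually_mem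
    ((trivializationAt E (fun x : M ↦ TangentSpace I x) (γ t)).open_baseSet.mem_nhds
      (mem_baseSet_trivializationAt' (γ t)))
  have hf : ∀ a : E, ∀ᶠ y in 𝓝 (γ t),
      ContMDiffAt I I.tangent ∞ (T% (frameField (I := I) (γ t) a)) y := fun a ↦ by
    rw [frameField_eq_extend]
    exact eventually_contMDiffAt_extend _
  have h0 : ∀ a b c : E, HasDerivAt
      (fun s ↦ cubicForm cov (γ s) (frameField (I := I) (γ t) a (γ s)) (frameField (γ t) b (γ s))
        (frameField (γ t) c (γ s)))
      (mvfderiv I (fun y ↦ cubicForm cov y (frameField (γ t) a y) (frameField (γ t) b y)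
        (frameField (γ t) c y)) (γ t) (velocity I γ t)) t := fun a b c ↦
    hasDerivAt_comp_curve hγ.contMDiff
      ((contMDiffAt_cubicForm hcov (hf a) (hf b) (hf c)).mdifferentiableAt (by simp))
  have h1 := fun b c ↦ hasDerivAt_isLinearMap_apply (hlin.mono fun s hs ↦
    ((isLinearMap_cubicForm_left _ _ _).mk'.comp (isLinearMap_frameField hs).mk').isLinear)
    (fun a ↦ h0 a b c) hv
  have h2 := fun c ↦ hasDerivAt_isLinearMap_apply (hlin.mono fun s hs ↦
    ((isLinearMap_cubicForm_middle _ _ _).mk'.comp (isLinearMap_frameField hs).mk').isLinear)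
    (fun b ↦ h1 b c) hv
  have h3 := hasDerivAt_isLinearMap_apply (hlin.mono fun s hs ↦
    ((isLinearMap_cubicForm_right _ _ _).mk'.comp (isLinearMap_frameField hs).mk').isLinear)
    h2 hv
  have hvt := (eventually_velocity_eq_frameField (I := I) hγ.contMDiff.continuous t)
  refine (h3.congr_of_eventuallyEq (hvt.mono fun s hs ↦ by simp only [← hs])).congr_deriv ?_
  -- Each slot contributes `-∇_γ̇ = -∇̂_γ̇ - K(γ̇, ·)`: the first parts complete `∇̂A`, the second
  -- are the correction terms.
  rw [hγ.frameField_deriv, ← hvt.self_of_nhds, nablaHatCubicForm]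
  simp only [velocityComponents, ← extend_eq_frameField, differenceTensor_eq_extend,
    (isLinearMap_cubicForm_left _ _ _).map_sub, (isLinearMap_cubicForm_middle _ _ _).map_sub,
    (isLinearMap_cubicForm_right _ _ _).map_sub, (isLinearMap_cubicForm_left _ _ _).map_neg,
    (isLinearMap_cubicForm_middle _ _ _).map_neg, (isLinearMap_cubicForm_right _ _ _).map_neg]
  ring

theorem IsStatistical.isTrivial_of_complete [T2Space M] (h : IsStatistical cov)
    (hcov : cov.ContMDiffCovariantDerivative ∞) (hc : IsGeodesicallyComplete cov)
    (hA : ∀ (x : M) (u : TangentSpace I x), ‖u‖ = 1 → nablaHatCubicForm cov x u u u u ≤ 0) :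
    IsTrivial cov := by
  -- Stated on the total space because the initial condition of a geodesic is an equality there,
  -- which can be rewritten without transporting tangent vectors.
  have key : ∀ p : TangentBundle I M, 0 ≤ cubicForm cov p.1 p.2 p.2 p.2 := by
    intro p
    obtain ⟨γ, hγ, h0⟩ := hc p.1 p.2
    rw [← show _ = p from h0]
    refine nonneg_of_riccati_system
      (s := fun t ↦ inner ℝ (velocity I γ t) (velocity I γ t))
      (φ := fun t ↦ cubicForm cov (γ t) (velocity I γ t) (velocity I γ t) (velocity I γ t))
      (q := fun t ↦ ‖differenceTensor cov (γ t) (velocity I γ t) (velocity I γ t)‖ ^ 2)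
      (fun t ↦ (hγ.hasDerivAt_norm_sq t).congr_deriv (by rw [nablaMetric_eq_cubicForm]; ring))
      (hγ.hasDerivAt_cubicForm hcov) (fun t ↦ ?_) (fun t ↦ real_inner_self_nonneg)
      (fun t ↦ sq_nonneg _) (fun t ↦ sq_cubicForm_diag_le _ _)
    rw [h.cubicForm_differenceTensor_sum]
    linarith [nablaHatCubicForm_nonpos hcov hA (γ t) (velocity I γ t)]
  refine isTrivial_of_cubicForm_diag h fun x u ↦ (key ⟨x, u⟩).antisymm' ?_
  -- The opposite inequality comes from the geodesic with reversed initial velocity, `A` being odd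
  -- on the diagonal.
  have : 0 ≤ cubicForm cov x (-u) (-u) (-u) := key ⟨x, -u⟩
  simp only [(isLinearMap_cubicForm_left x _ _).map_neg,
    (isLinearMap_cubicForm_middle x _ _).map_neg, (isLinearMap_cubicForm_right x _ _).map_neg] at this
  linarith

end Geodesics

/-! ### Brackets as commutators, and the Leibniz rule for multilinear maps. -/

section Commutator

variable {E : Type*} [NormedAddCommGroup E] [NormedSpace ℝ E] [CompleteSpace E]
  {H : Type*} [TopologicalSpace H] {I : ModelWithCorners ℝ E H} [I.Boundaryless]
  {M : Type*} [TopologicalSpace M] [ChartedSpace H M] [IsManifold I ∞ M]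
  {F : Type*} [NormedAddCommGroup F] [NormedSpace ℝ F]

theorem fderiv_comp_eq_mvfderiv {φ : E → M} {h : M → F} {q : E} (hh : MDiffAt h (φ q))
    (hφ : MDiffAt φ q) (w : E) :
    fderiv ℝ (h ∘ φ) q w = mvfderiv I h (φ q) (mfderiv 𝓘(ℝ, E) I φ q w) := by
  have h1 := mfderiv_comp q hh hφ
  rw [mfderiv_eq_fderiv] at h1
  exact congr($h1 w)

theorem contMDiffAt_extChartAt_symm (x : M) {q : E} (hq : q ∈ (extChartAt I x).target) :
    ContMDiffAt 𝓘(ℝ, E) I ∞ (extChartAt I x).symm q :=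
  (contMDiffOn_extChartAt_symm x).contMDiffAt ((isOpen_extChartAt_target x).mem_nhds hq)

theorem isInvertible_mfderiv_extChartAt_symm {x : M} {q : E} (hq : q ∈ (extChartAt I x).target) :
    (mfderiv 𝓘(ℝ, E) I (extChartAt I x).symm q).IsInvertible := by
  have h := isInvertible_mfderivWithin_extChartAt_symm hq
  rwa [I.range_eq_univ, mfderivWithin_univ] at h

/-- The bracket of vector fields is the commutator of the corresponding derivations. -/
theorem mvfderiv_mlieBracket {h : M → F} {X Y : Π x : M, TangentSpace I x} {x : M}
    (hh : ContMDiffAt I 𝓘(ℝ, F) ∞ h x) (hX : ContMDiffAt I I.tangent ∞ (T% X) x)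
    (hY : ContMDiffAt I I.tangent ∞ (T% Y) x) :
    mvfderiv I (fun y ↦ mvfderiv I h y (Y y)) x (X x)
      - mvfderiv I (fun y ↦ mvfderiv I h y (X y)) x (Y x)
      = mvfderiv I h x (mlieBracket I X Y x) := by
  have : IsManifold I (minSmoothness ℝ 3) M := by
    rw [minSmoothness_of_isRCLikeNormedField]
    exact IsManifold.of_le (n := ∞) ENat.LEInfty.out
  have h2 : minSmoothness ℝ 2 ≤ ∞ := by
    rw [minSmoothness_of_isRCLikeNormedField]; exact ENat.LEInfty.out
  set φ := (extChartAt I x).symm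
  set p := extChartAt I x x with hp
  have hpx : x = φ p := (extChartAt_to_inv x).symm
  have htp : ∀ᶠ q in 𝓝 p, q ∈ (extChartAt I x).target :=
    (isOpen_extChartAt_target x).mem_nhds (mem_extChartAt_target x)
  have hφ : ∀ᶠ q in 𝓝 p, ContMDiffAt 𝓘(ℝ, E) I ∞ φ q :=
    htp.mono fun q hq ↦ contMDiffAt_extChartAt_symm x hq
  have hinv : ∀ᶠ q in 𝓝 p, (mfderiv 𝓘(ℝ, E) I φ q).IsInvertible :=
    htp.mono fun q hq ↦ isInvertible_mfderiv_extChartAt_symm hq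
  rw [hpx] at hh hX hY ⊢
  -- `P` pulls vector fields back to the chart; only the three listed properties are used
  -- afterwards.
  obtain ⟨P, hpull, hpd, hbr⟩ : ∃ P : (Π x : M, TangentSpace I x) → E → E,
      (∀ (V : Π x : M, TangentSpace I x) (q : E), (mfderiv 𝓘(ℝ, E) I φ q).IsInvertible →
        mfderiv 𝓘(ℝ, E) I φ q (P V q) = V (φ q)) ∧
      (∀ V : Π x : M, TangentSpace I x, ContMDiffAt I I.tangent ∞ (T% V) (φ p) →
        DifferentiableAt ℝ (P V) p) ∧
      ∀ w : E, w = lieBracket ℝ (P X) (P Y) p →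
        mfderiv 𝓘(ℝ, E) I φ p w = mlieBracket I X Y (φ p) := by
    refine ⟨fun V ↦ mpullback 𝓘(ℝ, E) I φ V, fun V q hq ↦ hq.self_apply_inverse (V (φ q)),
      fun V hV ↦ (contMDiffAt_vectorSpace_iff_contDiffAt.1 (hV.mpullback_vectorField_preimage
        hφ.self_of_nhds hinv.self_of_nhds le_rfl)).differentiableAt (by simp), ?_⟩
    intro w hw
    have h1 := mpullback_mlieBracket (hX.mdifferentiableAt (by simp))
      (hY.mdifferentiableAt (by simp)) hφ.self_of_nhds h2
    have h3 : ∀ V W : E → E, mlieBracket 𝓘(ℝ, E) V W p = lieBracket ℝ V W p := fun V W ↦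
      (congrFun (mlieBracketWithin_univ (I := 𝓘(ℝ, E)) (V := V) (W := W)) p).symm.trans
        ((congrFun mlieBracketWithin_eq_lieBracketWithin p).trans (congrFun lieBracketWithin_univ p))
    exact (congrArg (mfderiv 𝓘(ℝ, E) I φ p) (hw.trans ((h3 _ _).symm.trans h1.symm))).trans
      (hinv.self_of_nhds.self_apply_inverse _)
  have hd : ∀ᶠ q in 𝓝 p, MDiffAt h (φ q) :=
    (hφ.self_of_nhds.continuousAt.eventually
      ((contMDiffAt_iff_contMDiffAt_nhds (n := 1) (by simp)).1 (hh.of_le ENat.LEInfty.out))).mono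
      fun q hq ↦ hq.mdifferentiableAt one_ne_zero
  have hg : ContDiffAt ℝ ∞ (h ∘ φ) p :=
    contMDiffAt_iff_contDiffAt.1 (hh.comp p hφ.self_of_nhds)
  have hg' : DifferentiableAt ℝ (fderiv ℝ (h ∘ φ)) p :=
    (hg.fderiv_right (m := ∞) le_rfl).differentiableAt (by simp)
  -- In the chart, `U(V h)` is a Hessian term plus a derivative of `V`; the Hessian is symmetric, so
  -- the commutator retains only the bracket.
  have hsecond : ∀ U V : Π x : M, TangentSpace I x, ContMDiffAt I I.tangent ∞ (T% V) (φ p) →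
      mvfderiv I (fun y ↦ mvfderiv I h y (V y)) (φ p) (U (φ p))
        = fderiv ℝ (fderiv ℝ (h ∘ φ)) p (P U p) (P V p)
          + fderiv ℝ (h ∘ φ) p (fderiv ℝ (P V) p (P U p)) := by
    intro U V hV
    have h1 := fderiv_comp_eq_mvfderiv
      ((contMDiffAt_mvfderiv_apply hh hV le_rfl).mdifferentiableAt (by simp))
      (hφ.self_of_nhds.mdifferentiableAt (by simp)) (P U p)
    rw [hpull U p hinv.self_of_nhds] at h1
    have h2 : (fun y ↦ mvfderiv I h y (V y)) ∘ φ =ᶠ[𝓝 p]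
        fun q ↦ fderiv ℝ (h ∘ φ) q (P V q) := by
      filter_upwards [hφ, hinv, hd] with q hq hq' hqd
      rw [fderiv_comp_eq_mvfderiv hqd (hq.mdifferentiableAt (by simp)), hpull V q hq']
      rfl
    rw [← h1, h2.fderiv_eq, (hg'.hasFDerivAt.clm_apply (hpd V hV).hasFDerivAt).fderiv]
    simp [add_comm]
  rw [hsecond X Y hY, hsecond Y X hX, (hg.isSymmSndFDerivAt h2).eq,
    add_sub_add_left_eq_sub, ← map_sub, ← hbr _ rfl, ← fderiv_comp_eq_mvfderiv hd.self_of_nhds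
      (hφ.self_of_nhds.mdifferentiableAt (by simp))]
  rfl

theorem hasFDerivAt_comp_extChartAt_symm {h : M → F} {x : M} {L : E →L[ℝ] F}
    (hh : HasMFDerivAt I 𝓘(ℝ, F) h x L) :
    HasFDerivAt (h ∘ (extChartAt I x).symm) L (extChartAt I x x) := by
  have h1 : HasFDerivWithinAt (h ∘ (extChartAt I x).symm) L (Set.range I) (extChartAt I x x) :=
    hh.2
  rwa [I.range_eq_univ, hasFDerivWithinAt_univ] at h1

theorem mvfderiv_multilinear_comp {ι : Type*} [Fintype ι] [DecidableEq ι]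
    (T : ContinuousMultilinearMap ℝ (fun _ : ι ↦ F) ℝ) {c : ι → M → F} {x : M}
    (hc : ∀ i, ContMDiffAt I 𝓘(ℝ, F) ∞ (c i) x) (u : TangentSpace I x) :
    mvfderiv I (fun y ↦ T (fun i ↦ c i y)) x u
      = ∑ i, T (Function.update (fun j ↦ c j x) i (mvfderiv I (c i) x u)) := by
  have hT : MDifferentiableAt I 𝓘(ℝ, ℝ) (fun y : M ↦ T (fun i ↦ c i y)) x :=
    ((T.contDiff (n := ∞)).contMDiff.contMDiffAt.comp x
      (contMDiffAt_pi_space.2 hc)).mdifferentiableAt (by simp)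
  let L : E →L[ℝ] ℝ := mvfderiv I (fun y ↦ T (fun i ↦ c i y)) x
  let L' : ι → E →L[ℝ] F := fun i ↦ mvfderiv I (c i) x
  have h1 := hasFDerivAt_comp_extChartAt_symm (L := L) hT.hasMFDerivAt
  have h2 := HasFDerivAt.multilinear_comp T fun i ↦ hasFDerivAt_comp_extChartAt_symm (L := L' i)
    ((hc i).mdifferentiableAt (by simp)).hasMFDerivAt
  let e : E := u
  have h3 := DFunLike.congr_fun (HasFDerivAt.unique h1 h2) e
  simp only [Function.comp_apply, extChartAt_to_inv, sum_apply,
    ContinuousLinearMap.comp_apply] at h3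
  exact h3

end Commutator

/-! ### The determinant. -/

section Determinant

variable {m : ℕ}

/-- The determinant with respect to the standard basis, as a continuous multilinear map. -/
noncomputable def detMultilinear (m : ℕ) :
    ContinuousMultilinearMap ℝ (fun _ : Fin m ↦ EuclideanSpace ℝ (Fin m)) ℝ where
  toMultilinearMap := (EuclideanSpace.basisFun (Fin m) ℝ).toBasis.det.toMultilinearMap
  cont := by
    change Continuous fun v ↦ (EuclideanSpace.basisFun (Fin m) ℝ).toBasis.det v
    simp only [Module.Basis.det_apply]
    refine Continuous.matrix_det (continuous_matrix fun i j ↦ ?_)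
    simp only [Module.Basis.toMatrix_apply, OrthonormalBasis.coe_toBasis_repr_apply,
      EuclideanSpace.basisFun_repr]
    fun_prop

theorem detMultilinear_apply (v : Fin m → EuclideanSpace ℝ (Fin m)) :
    detMultilinear m v = (EuclideanSpace.basisFun (Fin m) ℝ).toBasis.det v := rfl

/-- Otherwise the `m + 1` vectors would be independent, hence a basis, with nonzero determinant. -/
theorem mem_span_of_det_snoc_eq_zero {v : Fin m → EuclideanSpace ℝ (Fin (m + 1))}
    {w : EuclideanSpace ℝ (Fin (m + 1))} (hv : LinearIndependent ℝ v)
    (h : (EuclideanSpace.basisFun (Fin (m + 1)) ℝ).toBasis.det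
      (Fin.snoc (α := fun _ ↦ EuclideanSpace ℝ (Fin (m + 1))) v w) = 0) :
    w ∈ Submodule.span ℝ (Set.range v) := by
  by_contra hw
  have h1 := hv.finSnoc hw
  have h2 := (EuclideanSpace.basisFun (Fin (m + 1)) ℝ).toBasis.is_basis_iff_det.1
    ⟨h1, h1.span_eq_top_of_card_eq_finrank' (by simp)⟩
  exact h2.ne_zero h

end Determinant

/-! ### Equiaffine hypersurfaces induce statistical structures. -/

section Hypersurface

variable {n : ℕ} {M : Type*} [TopologicalSpace M] [T2Space M]
  [ChartedSpace (EuclideanSpace ℝ (Fin n)) M] [IsManifold (𝓡 n) ∞ M]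
  [RiemannianBundle (fun x : M ↦ TangentSpace (𝓡 n) x)]
  [IsContMDiffRiemannianBundle (𝓡 n) ∞ (EuclideanSpace ℝ (Fin n))
    (fun x : M ↦ TangentSpace (𝓡 n) x)]
  {f ξ : M → EuclideanSpace ℝ (Fin (n + 1))}
  {cov : CovariantDerivative (𝓡 n) (EuclideanSpace ℝ (Fin n))
    (fun x : M ↦ TangentSpace (𝓡 n) x)}

theorem mvfderiv_inducedVolume (hf : ContMDiff (𝓡 n) 𝓘(ℝ, EuclideanSpace ℝ (Fin (n + 1))) ∞ f)
    (hξ : ContMDiff (𝓡 n) 𝓘(ℝ, EuclideanSpace ℝ (Fin (n + 1))) ∞ ξ) {x : M}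
    {V : Fin n → Π x : M, TangentSpace (𝓡 n) x}
    (hV : ∀ i, ContMDiffAt (𝓡 n) (𝓡 n).tangent ∞ (T% (V i)) x) (u : TangentSpace (𝓡 n) x) :
    mvfderiv (𝓡 n) (fun y ↦ inducedVolume f ξ y (fun i ↦ V i y)) x u
      = ∑ i, detMultilinear (n + 1) (Fin.snoc (α := fun _ ↦ EuclideanSpace ℝ (Fin (n + 1)))
          (Function.update (fun i ↦ mvfderiv (𝓡 n) f x (V i x)) i
            (mvfderiv (𝓡 n) (fun y ↦ mvfderiv (𝓡 n) f y (V i y)) x u)) (ξ x))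
        + detMultilinear (n + 1) (Fin.snoc (α := fun _ ↦ EuclideanSpace ℝ (Fin (n + 1)))
          (fun i ↦ mvfderiv (𝓡 n) f x (V i x)) (mvfderiv (𝓡 n) ξ x u)) := by
  let c : Fin (n + 1) → M → EuclideanSpace ℝ (Fin (n + 1)) := fun i y ↦
    Fin.snoc (α := fun _ ↦ EuclideanSpace ℝ (Fin (n + 1)))
      (fun i ↦ mvfderiv (𝓡 n) f y (V i y)) (ξ y) i
  have hc1 : ∀ i, c (Fin.castSucc i) = fun y ↦ mvfderiv (𝓡 n) f y (V i y) := fun i ↦ by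
    ext1 y; simp [c]
  have hc2 : c (Fin.last n) = ξ := by ext1 y; simp [c]
  have hc : ∀ i, ContMDiffAt (𝓡 n) 𝓘(ℝ, EuclideanSpace ℝ (Fin (n + 1))) ∞ (c i) x := fun i ↦ by
    refine Fin.lastCases ?_ (fun i ↦ ?_) i
    · rw [hc2]; exact hξ.contMDiffAt
    · rw [hc1]; exact contMDiffAt_mvfderiv_apply hf.contMDiffAt (hV i) le_rfl
  have h3 := mvfderiv_multilinear_comp (detMultilinear (n + 1)) hc u
  rw [Fin.sum_univ_castSucc] at h3
  simp only [hc1, hc2] at h3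
  refine h3.trans (congr_arg₂ _ (Finset.sum_congr rfl fun i _ ↦ ?_) ?_)
  · rw [Fin.snoc_update]
  · rw [← Fin.update_snoc_last (x := ξ x)]

/-- In `∇ν_ξ = 0`, the product rule and the Gauss formula cancel every term but `det(f_*b₁, …,
f_*bₙ, D_u ξ)`, which must therefore vanish. -/
theorem IsInducedByEquiaffineHypersurface.mvfderiv_transversal_mem_range
    (h : IsInducedByEquiaffineHypersurface f ξ cov) (x : M) (u : TangentSpace (𝓡 n) x) :
    mvfderiv (𝓡 n) ξ x u ∈ (mvfderiv (𝓡 n) f x).range := by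
  let b : Module.Basis (Fin n) ℝ (TangentSpace (𝓡 n) x) :=
    (EuclideanSpace.basisFun (Fin n) ℝ).toBasis
  have hb : ∀ i, ContMDiffAt (𝓡 n) (𝓡 n).tangent ∞
      (T% (extend (EuclideanSpace ℝ (Fin n)) (b i))) x := fun i ↦
    (eventually_contMDiffAt_extend (b i)).self_of_nhds
  have h1 := h.equiaffine x u b
  rw [mvfderiv_inducedVolume h.contMDiff_immersion h.contMDiff_transversal hb] at h1
  have h2 : ∀ i, detMultilinear (n + 1) (Fin.snoc (α := fun _ ↦ EuclideanSpace ℝ (Fin (n + 1)))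
          (Function.update (fun i ↦ mvfderiv (𝓡 n) f x (extend (EuclideanSpace ℝ (Fin n)) (b i) x))
            i (mvfderiv (𝓡 n) (fun y ↦ mvfderiv (𝓡 n) f y
              (extend (EuclideanSpace ℝ (Fin n)) (b i) y)) x u)) (ξ x))
        = inducedVolume f ξ x
          (Function.update b i (cov (extend (EuclideanSpace ℝ (Fin n)) (b i)) x u)) := by
    intro i
    rw [h.gauss _ x (mdifferentiableAt_of_contMDiffAt (hb i)), Fin.snoc_update,
      ContinuousMultilinearMap.map_update_add, ContinuousMultilinearMap.map_update_smul]
    -- The `ξ`-part of the Gauss formula puts `ξ` into two slots of the determinant.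
    have h3 : detMultilinear (n + 1) (Function.update
        (Fin.snoc (α := fun _ ↦ EuclideanSpace ℝ (Fin (n + 1)))
          (fun i ↦ mvfderiv (𝓡 n) f x (extend (EuclideanSpace ℝ (Fin n)) (b i) x)) (ξ x))
          i.castSucc (ξ x)) = 0 := by
      rw [detMultilinear_apply]
      refine AlternatingMap.map_eq_zero_of_eq _ _ (i := i.castSucc) (j := Fin.last n) ?_
        (Fin.castSucc_lt_last i).ne
      rw [Function.update_self, Function.update_of_ne (Fin.castSucc_lt_last i).ne', Fin.snoc_last]
    rw [h3, smul_zero, add_zero, ← Fin.snoc_update, detMultilinear_apply, inducedVolume]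
    congr 2
    ext1 j
    by_cases hj : j = i
    · subst hj; simp
    · simp [hj]
  rw [Finset.sum_congr rfl (fun i _ ↦ h2 i), add_sub_cancel_left] at h1
  simp only [extend_apply_self] at h1
  have h3 : LinearIndependent ℝ (fun i ↦ mvfderiv (𝓡 n) f x (b i)) :=
    b.linearIndependent.map' (mvfderiv (𝓡 n) f x).toLinearMap
      (LinearMap.ker_eq_bot.2 (h.injective_mvfderiv x))
  refine (Submodule.span_le.2 ?_) (mem_span_of_det_snoc_eq_zero h3 h1)
  rintro _ ⟨i, rfl⟩
  exact ⟨b i, rfl⟩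

theorem IsInducedByEquiaffineHypersurface.coeff_eq (h : IsInducedByEquiaffineHypersurface f ξ cov)
    {x : M} {a b : TangentSpace (𝓡 n) x} {c d : ℝ}
    (hab : mvfderiv (𝓡 n) f x a + c • ξ x = mvfderiv (𝓡 n) f x b + d • ξ x) : c = d := by
  -- If `ξ x` were zero, `f_*` would map an `n`-dimensional space onto an `(n + 1)`-dimensional one.
  have hξ : ξ x ≠ 0 := by
    intro h0
    have h1 := (h.transversal x).sup_eq_top
    rw [h0, Submodule.span_zero_singleton, sup_bot_eq] at h1
    have h2 := LinearMap.finrank_range_le (mvfderiv (𝓡 n) f x).toLinearMap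
    rw [h1, finrank_top, finrank_euclideanSpace_fin,
      show Module.finrank ℝ (TangentSpace (𝓡 n) x) = n from finrank_euclideanSpace_fin] at h2
    omega
  have h3 : (c - d) • ξ x ∈ (mvfderiv (𝓡 n) f x).range :=
    ⟨b - a, by
      rw [sub_smul, ContinuousLinearMap.coe_coe, map_sub]
      exact sub_eq_sub_iff_add_eq_add.2 (hab.symm.trans (add_comm _ _))⟩
  have h4 := Submodule.disjoint_def.1 (h.transversal x).disjoint _ h3
    (Submodule.smul_mem _ _ (Submodule.mem_span_singleton_self _))
  exact sub_eq_zero.1 ((smul_eq_zero.1 h4).resolve_right hξ)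

/-- In the commutator formula for `f` the `ξ`-terms cancel by symmetry of `g`, and `f_*` is
injective. -/
theorem IsInducedByEquiaffineHypersurface.torsion_eq_zero
    (h : IsInducedByEquiaffineHypersurface f ξ cov) : cov.torsion = 0 := by
  ext x u v : 3
  have hu := (eventually_contMDiffAt_extend u).self_of_nhds
  have hv := (eventually_contMDiffAt_extend v).self_of_nhds
  have h1 := mvfderiv_mlieBracket h.contMDiff_immersion.contMDiffAt hu hv
  rw [h.gauss _ _ (mdifferentiableAt_of_contMDiffAt hu),
    h.gauss _ _ (mdifferentiableAt_of_contMDiffAt hv),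
    real_inner_comm, add_sub_add_right_eq_sub, ← map_sub] at h1
  rw [cov.torsion_apply_eq_extend, h.injective_mvfderiv x h1, sub_self]
  rfl

/-- The Codazzi equation. -/
theorem IsInducedByEquiaffineHypersurface.nablaMetric_swap_left
    (h : IsInducedByEquiaffineHypersurface f ξ cov) (hcov : cov.ContMDiffCovariantDerivative ∞)
    (x : M) (u v w : TangentSpace (𝓡 n) x) :
    nablaMetric cov x u v w = nablaMetric cov x v u w := by
  -- `S` is, up to sign, the shape operator: `D_u ξ = f_*(S u)`.
  choose S hS using h.mvfderiv_transversal_mem_range x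
  have hZ := eventually_contMDiffAt_extend w
  have hk := contMDiffAt_mvfderiv_apply h.contMDiff_immersion.contMDiffAt hZ.self_of_nhds le_rfl
  -- The Gauss formula is used twice; since `D_a ξ` is tangential, the `ξ`-coefficient contains no
  -- further term.
  have key : ∀ a b : TangentSpace (𝓡 n) x,
      mvfderiv (𝓡 n) (fun y ↦ mvfderiv (𝓡 n) (fun y ↦ mvfderiv (𝓡 n) f y
          (extend (EuclideanSpace ℝ (Fin n)) w y)) y (extend (EuclideanSpace ℝ (Fin n)) b y)) x a
        = mvfderiv (𝓡 n) f x (cov (fun y ↦ cov (extend (EuclideanSpace ℝ (Fin n)) w) y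
            (extend (EuclideanSpace ℝ (Fin n)) b y)) x a + inner ℝ b w • S a)
          + (inner ℝ a (cov (extend (EuclideanSpace ℝ (Fin n)) w) x b)
            + mvfderiv (𝓡 n) (fun y ↦ (inner ℝ (extend (EuclideanSpace ℝ (Fin n)) b y)
              (extend (EuclideanSpace ℝ (Fin n)) w y) : ℝ)) x a) • ξ x := by
    intro a b
    have hb := (eventually_contMDiffAt_extend b).self_of_nhds
    have hW := contMDiffAt_covariantDerivative hcov hb hZ
    have hi := contMDiffAt_inner hb hZ.self_of_nhds
    have hξ := h.contMDiff_transversal.contMDiffAt (x := x)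
    have h1 : (fun y ↦ mvfderiv (𝓡 n) (fun y ↦ mvfderiv (𝓡 n) f y
          (extend (EuclideanSpace ℝ (Fin n)) w y)) y (extend (EuclideanSpace ℝ (Fin n)) b y))
        =ᶠ[𝓝 x] fun y ↦ mvfderiv (𝓡 n) f y (cov (extend (EuclideanSpace ℝ (Fin n)) w) y
            (extend (EuclideanSpace ℝ (Fin n)) b y))
          + (inner ℝ (extend (EuclideanSpace ℝ (Fin n)) b y)
            (extend (EuclideanSpace ℝ (Fin n)) w y) : ℝ) • ξ y := by
      filter_upwards [hZ] with y hy
      exact h.gauss _ y (mdifferentiableAt_of_contMDiffAt hy) _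
    have h2 := mvfderiv_fun_add
      ((contMDiffAt_mvfderiv_apply h.contMDiff_immersion.contMDiffAt hW le_rfl).mdifferentiableAt
        (by simp)) ((hi.mdifferentiableAt (by simp)).smul (hξ.mdifferentiableAt (by simp)))
    have h3 : mvfderiv (𝓡 n) (fun y ↦ mvfderiv (𝓡 n) (fun y ↦ mvfderiv (𝓡 n) f y
          (extend (EuclideanSpace ℝ (Fin n)) w y)) y (extend (EuclideanSpace ℝ (Fin n)) b y)) x
        = mvfderiv (𝓡 n) (fun y ↦ mvfderiv (𝓡 n) f y (cov (extend (EuclideanSpace ℝ (Fin n)) w) y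
            (extend (EuclideanSpace ℝ (Fin n)) b y))) x
          + mvfderiv (𝓡 n) (fun y ↦ (inner ℝ (extend (EuclideanSpace ℝ (Fin n)) b y)
            (extend (EuclideanSpace ℝ (Fin n)) w y) : ℝ) • ξ y) x :=
      (congrArg (_ ∘L ·) h1.mfderiv_eq).trans h2
    rw [h3, add_apply, h.gauss _ x (mdifferentiableAt_of_contMDiffAt hW),
      mvfderiv_fun_smul (hi.mdifferentiableAt (by simp)) (hξ.mdifferentiableAt (by simp))]
    simp only [extend_apply_self, add_apply, smul_apply, ContinuousLinearMap.smulRight_apply,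
      map_add, map_smul]
    rw [← hS a]
    simp only [ContinuousLinearMap.coe_coe]
    module
  -- The commutator formula for `f_*W`, with `W` extending `w`, expresses flatness of `D`. Its
  -- `ξ`-component is the Codazzi equation once zero torsion rewrites the bracket.
  have h1 := mvfderiv_mlieBracket hk (eventually_contMDiffAt_extend u).self_of_nhds
    (eventually_contMDiffAt_extend v).self_of_nhds
  rw [extend_apply_self, extend_apply_self, key, key,
    h.gauss _ x (mdifferentiableAt_of_contMDiffAt hZ.self_of_nhds)] at h1
  rw [add_sub_add_comm, ← map_sub, ← sub_smul] at h1
  have h2 := h.coeff_eq h1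
  have h3 := cov.torsion_eq_zero_iff.1 h.torsion_eq_zero (mdifferentiableAt_extend _ _ u)
    (mdifferentiableAt_extend _ _ v)
  simp only [extend_apply_self] at h2 h3
  rw [← h3, inner_sub_left] at h2
  rw [nablaMetric_eq, nablaMetric_eq]
  linarith

theorem IsInducedByEquiaffineHypersurface.isStatistical
    (h : IsInducedByEquiaffineHypersurface f ξ cov) (hcov : cov.ContMDiffCovariantDerivative ∞) :
    IsStatistical cov where
  torsion_eq_zero := h.torsion_eq_zero
  symm_left := h.nablaMetric_swap_left hcov
  -- This symmetry holds for every connection, `g` being symmetric.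
  symm_right x u v w := by
    rw [nablaMetric_eq_cubicForm, nablaMetric_eq_cubicForm]
    ring

end Hypersurface

end StatGeom

/-! ### The three statements. -/

theorem theorem4p1 {n : ℕ} {M : Type*} [TopologicalSpace M] [T2Space M]
    [ChartedSpace (EuclideanSpace ℝ (Fin n)) M] [IsManifold (𝓡 n) ∞ M]
    [RiemannianBundle (fun x : M ↦ TangentSpace (𝓡 n) x)]
    [IsContMDiffRiemannianBundle (𝓡 n) ∞ (EuclideanSpace ℝ (Fin n))
      (fun x : M ↦ TangentSpace (𝓡 n) x)]
    (cov : CovariantDerivative (𝓡 n) (EuclideanSpace ℝ (Fin n))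
      (fun x : M ↦ TangentSpace (𝓡 n) x))
    (hcov : CovariantDerivative.ContMDiffCovariantDerivative cov ∞) :
    (StatGeom.IsStatistical cov → StatGeom.IsGeodesicallyComplete cov →
      (∀ (x : M) (u : TangentSpace (𝓡 n) x), ‖u‖ = 1 →
        StatGeom.nablaHatCubicForm cov x u u u u ≤ 0) →
      StatGeom.IsTrivial cov) ∧
    (StatGeom.IsStatistical cov → StatGeom.HasParallelCubicForm cov →
      ¬ StatGeom.IsTrivial cov → ¬ StatGeom.IsGeodesicallyComplete cov) ∧
    (∀ f ξ : M → EuclideanSpace ℝ (Fin (n + 1)),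
      StatGeom.IsInducedByEquiaffineHypersurface f ξ cov → StatGeom.HasParallelCubicForm cov →
      ¬ StatGeom.IsTrivial cov → ¬ StatGeom.IsGeodesicallyComplete cov) := by
  have part2 : StatGeom.IsStatistical cov → StatGeom.HasParallelCubicForm cov →
      ¬ StatGeom.IsTrivial cov → ¬ StatGeom.IsGeodesicallyComplete cov := fun h hpar htriv hc ↦
    htriv (h.isTrivial_of_complete hcov hc fun x u _ ↦ (hpar x u u u u).le)
  exact ⟨fun h hc hA ↦ h.isTrivial_of_complete hcov hc hA, part2,
    fun f ξ h ↦ part2 (h.isStatistical hcov)⟩
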